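/- Let $\mathbb{K}$ be a field of characteristic zero, let $n\ge 1$, and let $X_1,\dots,X_n$ be non-commuting variables. In the algebra $\mathbb{K}\langle\langle X_1,\dots,X_n\rangle\rangle$ of formal power series in these variables, with $[A,B]=AB-BA$, put $$\Phi(X_1,\dots,X_n)=\log\big(e^{X_1}e^{X_2}\cdots e^{X_n}\big)=\sum_{k\ge1}\frac{(-1)^{k-1}}{k}\big(e^{X_1}e^{X_2}\cdots e^{X_n}-1\big)^k ,$$ let $\Phi_n(X_1,\dots,X_n)$ be its homogeneous component of degree $n$, and let $\varphi_n(X_1,\dots,X_n)$ be the multilinear part of $\Phi_n$, that is, the sum of those terms of $\Phi_n$ in which no variable is repeated (so that each of $X_1,\dots,X_n$ occurs exactly once). Then $$\varphi_n(X_1,\dots,X_n)=\frac1n\sum_{\sigma\in S_{n-1}}(-1)^{d_\sigma}\,\frac{1}{\binom{n-1}{d_\sigma}}\,[X_{\sigma(1)},[X_{\sigma(2)},\cdots,[X_{\sigma(n-1)},X_n]\cdots]],$$ where $S_{n-1}$ is the group of permutations of $\{1,\dots,n-1\}$ and $d_\sigma$ is the number of descents of $\sigma$, i.e. of indices $i\in\{1,\dots,n-2\}$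 with $\sigma(i)>\sigma(i+1)$ (for $n=1$ the sum consists of the single term $X_1$). Moreover, the $(n-1)!$ commutators $[X_{\sigma(1)},[X_{\sigma(2)},\cdots,[X_{\sigma(n-1)},X_n]\cdots]]$, $\sigma\in S_{n-1}$, are linearly independent over $\mathbb{K}$. -/

import Mathlib

/-- Formal power series in noncommuting variables indexed by `ι` with coefficients in `K`:
a series is the function that sends a word (a list of letters) to its coefficient. -/
def NCSeries (ι K : Type*) : Type _ := List ι → K

namespace NCSeries

variable {ι K : Type*}

/-- The coefficient of the word `w` in the series `f`. -/
def coeff (f : NCSeries ι K) (w : List ι) : K := f w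

@[ext]
theorem ext {f g : NCSeries ι K} (h : ∀ w, f.coeff w = g.coeff w) : f = g := funext h

instance [AddCommGroup K] : AddCommGroup (NCSeries ι K) :=
  inferInstanceAs (AddCommGroup (List ι → K))

instance [CommRing K] : Module K (NCSeries ι K) :=
  inferInstanceAs (Module K (List ι → K))

section CommRing

variable [CommRing K]

/-- The product: the coefficient of `w` in `f * g` is the sum of `f.coeff u * g.coeff v`
over all factorizations `w = u ++ v`. -/
instance : Mul (NCSeries ι K) :=
  ⟨fun f g w => ∑ i ∈ Finset.range (w.length + 1), f (w.take i) * g (w.drop i)⟩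

instance : One (NCSeries ι K) := ⟨fun w => if w.length = 0 then 1 else 0⟩

theorem coeff_mul (f g : NCSeries ι K) (w : List ι) :
    (f * g).coeff w =
      ∑ i ∈ Finset.range (w.length + 1), f.coeff (w.take i) * g.coeff (w.drop i) := rfl

theorem coeff_one (w : List ι) :
    (1 : NCSeries ι K).coeff w = if w.length = 0 then 1 else 0 := rfl

@[simp] theorem coeff_zero (w : List ι) : (0 : NCSeries ι K).coeff w = 0 := rfl

@[simp] theorem coeff_add (f g : NCSeries ι K) (w : List ι) :
    (f + g).coeff w = f.coeff w + g.coeff w := rfl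

@[simp] theorem coeff_neg (f : NCSeries ι K) (w : List ι) : (-f).coeff w = -f.coeff w := rfl

@[simp] theorem coeff_sub (f g : NCSeries ι K) (w : List ι) :
    (f - g).coeff w = f.coeff w - g.coeff w := rfl

@[simp] theorem coeff_smul (c : K) (f : NCSeries ι K) (w : List ι) :
    (c • f).coeff w = c * f.coeff w := rfl

/-- The series of the words of `f` that begin with the letter `a`, with this letter removed. -/
def tail (a : ι) (f : NCSeries ι K) : NCSeries ι K := fun w => f (a :: w)

theorem coeff_tail (a : ι) (f : NCSeries ι K) (w : List ι) :
    (tail a f).coeff w = f.coeff (a :: w) := rfl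

theorem coeff_mul_nil (f g : NCSeries ι K) : (f * g).coeff [] = f.coeff [] * g.coeff [] := by
  simp [coeff_mul]

theorem coeff_mul_cons (f g : NCSeries ι K) (a : ι) (w : List ι) :
    (f * g).coeff (a :: w) = f.coeff [] * g.coeff (a :: w) + (tail a f * g).coeff w := by
  rw [coeff_mul, List.length_cons, Finset.sum_range_succ', add_comm]
  simp [coeff_mul, coeff_tail]

protected theorem one_mul' (f : NCSeries ι K) : 1 * f = f := by
  ext w
  rw [coeff_mul, Finset.sum_eq_single 0]
  · simp [coeff_one]
  · intro i hi h0
    rw [Finset.mem_range] at hi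
    have : (w.take i).length ≠ 0 := by rw [List.length_take]; omega
    rw [coeff_one, if_neg this, zero_mul]
  · simp

protected theorem mul_one' (f : NCSeries ι K) : f * 1 = f := by
  ext w
  rw [coeff_mul, Finset.sum_eq_single w.length]
  · simp [coeff_one]
  · intro i hi h0
    rw [Finset.mem_range] at hi
    have : (w.drop i).length ≠ 0 := by rw [List.length_drop]; omega
    rw [coeff_one, if_neg this, mul_zero]
  · simp

protected theorem add_mul' (f g h : NCSeries ι K) : (f + g) * h = f * h + g * h := by
  ext w; simp [coeff_mul, add_mul, Finset.sum_add_distrib]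

protected theorem mul_add' (f g h : NCSeries ι K) : f * (g + h) = f * g + f * h := by
  ext w; simp [coeff_mul, mul_add, Finset.sum_add_distrib]

protected theorem smul_mul' (c : K) (f g : NCSeries ι K) : (c • f) * g = c • (f * g) := by
  ext w; simp [coeff_mul, Finset.mul_sum, mul_assoc]

protected theorem mul_smul' (c : K) (f g : NCSeries ι K) : f * (c • g) = c • (f * g) := by
  ext w; simp [coeff_mul, Finset.mul_sum, mul_left_comm]

theorem tail_mul (a : ι) (f g : NCSeries ι K) :
    tail a (f * g) = f.coeff [] • tail a g + tail a f * g := by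
  ext w
  rw [coeff_tail, coeff_mul_cons]
  rfl

protected theorem mul_assoc' (f g h : NCSeries ι K) : f * g * h = f * (g * h) := by
  ext w
  induction w generalizing f g h with
  | nil => simp only [coeff_mul_nil, mul_assoc]
  | cons a w ih =>
    rw [coeff_mul_cons, coeff_mul_cons, tail_mul, NCSeries.add_mul', coeff_add, ih,
      NCSeries.smul_mul', coeff_smul, coeff_mul_nil, coeff_mul_cons]
    ring

instance : Ring (NCSeries ι K) :=
  { (inferInstance : AddCommGroup (NCSeries ι K)) with
    mul := (· * ·)
    one := 1
    one_mul := NCSeries.one_mul'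
    mul_one := NCSeries.mul_one'
    mul_assoc := NCSeries.mul_assoc'
    left_distrib := NCSeries.mul_add'
    right_distrib := NCSeries.add_mul'
    zero_mul := fun f => by ext w; simp [coeff_mul]
    mul_zero := fun f => by ext w; simp [coeff_mul] }

instance : Algebra K (NCSeries ι K) :=
  Algebra.ofModule NCSeries.smul_mul' NCSeries.mul_smul'

/-- The variable `X_i`. -/
def X [DecidableEq ι] (i : ι) : NCSeries ι K := fun w => if w = [i] then 1 else 0

/-- The `k`-th power of a series without constant term involves only words of length at least
`k`. Hence the coefficient of `w` in `∑ k, c k • f ^ k` is a sum over `k ≤ w.length`. -/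
theorem coeff_pow_eq_zero {f : NCSeries ι K} (hf : f.coeff [] = 0) {k : ℕ} {w : List ι}
    (hw : w.length < k) : (f ^ k).coeff w = 0 := by
  induction k generalizing w with
  | zero => omega
  | succ k ih =>
    rw [pow_succ', coeff_mul]
    refine Finset.sum_eq_zero fun i hi => ?_
    rw [Finset.mem_range] at hi
    rcases Nat.eq_zero_or_pos i with rfl | h0
    · simp [hf]
    · rw [ih (by rw [List.length_drop]; omega), mul_zero]

/-- The homogeneous component of degree `m`. -/
def homogeneousPart (m : ℕ) (f : NCSeries ι K) : NCSeries ι K :=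
  fun w => if w.length = m then f w else 0

/-- The multilinear part: the words in which some variable is repeated are discarded. -/
def multilinearPart [DecidableEq ι] (f : NCSeries ι K) : NCSeries ι K :=
  fun w => if w.Nodup then f w else 0

end CommRing

section Field

variable [Field K]

/-- `exp f = ∑_{k ≥ 0} f ^ k / k!`, for a series `f` without constant term (by
`coeff_pow_eq_zero` the terms with `k > w.length` do not contribute to the coefficient of
`w`). -/
def exp (f : NCSeries ι K) : NCSeries ι K :=
  fun w => ∑ k ∈ Finset.range (w.length + 1), 1 / (k.factorial : K) * (f ^ k).coeff w

/-- `log g = ∑_{k ≥ 1} (-1) ^ (k - 1) / k * (g - 1) ^ k`, for a series `g` with constant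
term `1` (by `coeff_pow_eq_zero` the terms with `k > w.length` do not contribute to the
coefficient of `w`). -/
def log (g : NCSeries ι K) : NCSeries ι K :=
  fun w => ∑ k ∈ Finset.Icc 1 w.length, (-1 : K) ^ (k - 1) / (k : K) * ((g - 1) ^ k).coeff w

end Field

end NCSeries

namespace BCH

open NCSeries

/-- The Baker-Campbell-Hausdorff series `Φ(X_1, …, X_n) = log (exp X_1 * ⋯ * exp X_n)`. The
variables are indexed by `0, …, n - 1`. -/
def bchSeries (K : Type*) [Field K] (n : ℕ) : NCSeries (Fin n) K :=
  NCSeries.log (List.ofFn fun i : Fin n => NCSeries.exp (X i : NCSeries (Fin n) K)).prod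

/-- `Φ_m(X_1, …, X_n)`, the homogeneous part of degree `m` of the series `Φ`. -/
def bchTerm (K : Type*) [Field K] (n m : ℕ) : NCSeries (Fin n) K :=
  homogeneousPart m (bchSeries K n)

/-- `φ_n(X_1, …, X_n)`, the multilinear part of `Φ_n(X_1, …, X_n)`. -/
def bchMultilinear (K : Type*) [Field K] (n : ℕ) : NCSeries (Fin n) K :=
  multilinearPart (bchTerm K n n)

/-- The number of descents of a permutation `σ`, i.e. of positions `i` with
`σ i > σ (i + 1)`. -/
def descents {n : ℕ} (σ : Equiv.Perm (Fin n)) : ℕ :=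
  (Finset.univ.filter fun i : Fin n => ∃ h : i.val + 1 < n, σ i > σ ⟨i.val + 1, h⟩).card

/-- The right-nested commutator `[a_1, [a_2, …, [a_k, x] …]]` (equal to `x` if `k = 0`). -/
def rightNested {A : Type*} [Ring A] (l : List A) (x : A) : A :=
  l.foldr (fun a b => ⁅a, b⁆) x

/-- For a permutation `σ` of the first `n` of the variables `X_1, …, X_{n+1}`, the commutator
`[X_{σ(1)}, [X_{σ(2)}, …, [X_{σ(n)}, X_{n+1}] …]]`. -/
def dragtForest (K : Type*) [Field K] (n : ℕ) (σ : Equiv.Perm (Fin n)) :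
    NCSeries (Fin (n + 1)) K :=
  rightNested (List.ofFn fun i : Fin n => (X (σ i).castSucc : NCSeries (Fin (n + 1)) K))
    (X (Fin.last n))

end BCH

/-! Put `g = e^{X_1} ⋯ e^{X_n}` and `y = X_n`; only words without repeated letters matter. The
coefficient of such a word in `g ^ m` is a polynomial in `m` whose linear coefficient is the
coefficient in `log g`. Two facts follow. First, the coefficient in `g ^ m` counts the ways to cut
the word into `m` increasing, possibly empty factors, a binomial coefficient depending only on the
number of descents (`coeff_pow_eq_choose`). Its linear term gives the constants of the formula
(`coeff_log_eq`). Second, `g` and all its powers are multiplicative for shuffles, so `log g`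
vanishes on shuffles of nonempty words (`IsShuffleChar.shuffleSum_log`). Hence its coefficient at `u
y v` is `(-1)^|v|` times its sum over words `w y`, with `w` a shuffle of `u` and reversed `v`. The
nested commutators obey the same rule (`coeff_rightNested`), and at words ending in `y` they form a
dual basis. This yields both the expansion, whose coefficients are those of `log g` at the words `σ
y`, and linear independence. -/

namespace List

/-! ### Shuffles of words -/

variable {α : Type*}

/-- The list of all shuffles of two words, with multiplicity. -/
def shuffles : List α → List α → List (List α)
  | [], v => [v]
  | a :: u, [] => [a :: u]
  | a :: u, b :: v =>
    (shuffles u (b :: v)).map (a :: ·) ++ (shuffles (a :: u) v).map (b :: ·)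

@[simp] theorem shuffles_nil_left (v : List α) : shuffles [] v = [v] := by
  simp [shuffles]

@[simp] theorem shuffles_nil_right (u : List α) : shuffles u [] = [u] := by
  cases u <;> simp [shuffles]

theorem shuffles_cons_cons (a b : α) (u v : List α) :
    shuffles (a :: u) (b :: v) =
      (shuffles u (b :: v)).map (a :: ·) ++ (shuffles (a :: u) v).map (b :: ·) := by
  rw [shuffles]

theorem perm_append_of_mem_shuffles {u v w : List α} (h : w ∈ shuffles u v) :
    w.Perm (u ++ v) := by
  induction u, v using shuffles.induct generalizing w with
  | case1 v => simp_all
  | case2 a u => simp_all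
  | case3 a u b v ih₁ ih₂ =>
    rw [shuffles_cons_cons, mem_append, mem_map, mem_map] at h
    rcases h with ⟨x, hx, rfl⟩ | ⟨x, hx, rfl⟩
    · exact (ih₁ hx).cons a
    · exact ((ih₂ hx).cons b).trans perm_middle.symm

/-- The sum of the values of a function over the shuffles of two words. -/
def shuffleSum {M : Type*} [AddCommMonoid M] (f : List α → M) (u v : List α) : M :=
  ((shuffles u v).map f).sum

section AddCommMonoid

variable {M : Type*} [AddCommMonoid M]

@[simp] theorem shuffleSum_nil_left (f : List α → M) (v : List α) :
    shuffleSum f [] v = f v := by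
  simp [shuffleSum]

@[simp] theorem shuffleSum_nil_right (f : List α → M) (u : List α) :
    shuffleSum f u [] = f u := by
  simp [shuffleSum]

theorem shuffleSum_cons_cons (f : List α → M) (a b : α) (u v : List α) :
    shuffleSum f (a :: u) (b :: v) =
      shuffleSum (fun w => f (a :: w)) u (b :: v) +
        shuffleSum (fun w => f (b :: w)) (a :: u) v := by
  simp [shuffleSum, shuffles_cons_cons, Function.comp_def]

theorem shuffleSum_congr {f g : List α → M} {u v : List α}
    (h : ∀ w, w.Perm (u ++ v) → f w = g w) : shuffleSum f u v = shuffleSum g u v := by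
  unfold shuffleSum
  congr 1
  exact map_congr_left fun w hw => h w (perm_append_of_mem_shuffles hw)

theorem map_shuffleSum {N : Type*} [AddCommMonoid N] (φ : M →+ N) (f : List α → M)
    (u v : List α) : φ (shuffleSum f u v) = shuffleSum (fun w => φ (f w)) u v := by
  simp [shuffleSum, map_list_sum, Function.comp_def]

theorem shuffleSum_add (f g : List α → M) (u v : List α) :
    shuffleSum (fun w => f w + g w) u v = shuffleSum f u v + shuffleSum g u v := by
  simp [shuffleSum, sum_map_add]

/-- The defining recursion splits by first letter; this is its mirror image by last letter, needed
for reversal. -/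
theorem shuffleSum_concat_concat (f : List α → M) (a b : α) (u v : List α) :
    shuffleSum f (u ++ [a]) (v ++ [b]) =
      shuffleSum (fun w => f (w ++ [a])) u (v ++ [b]) +
        shuffleSum (fun w => f (w ++ [b])) (u ++ [a]) v := by
  induction u generalizing f v with
  | nil =>
    induction v generalizing f with
    | nil => simp [shuffleSum_cons_cons, add_comm]
    | cons d v ihv =>
      simp only [nil_append, cons_append, shuffleSum_cons_cons, shuffleSum_nil_left] at ihv ⊢
      rw [ihv]
      abel
  | cons c u ihu =>
    induction v generalizing f with
    | nil =>
      have h := ihu (fun w => f (c :: w)) []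
      simp only [nil_append, cons_append, shuffleSum_cons_cons, shuffleSum_nil_right] at h ⊢
      rw [h]
      abel
    | cons d v ihv =>
      have h := ihu (fun w => f (c :: w)) (d :: v)
      simp only [cons_append, shuffleSum_cons_cons] at h ihv ⊢
      rw [h, ihv]
      abel

theorem shuffleSum_reverse (f : List α → M) (u v : List α) :
    shuffleSum (fun w => f w.reverse) u v = shuffleSum f u.reverse v.reverse := by
  induction u, v using shuffles.induct generalizing f with
  | case1 v => simp
  | case2 a u => simp
  | case3 a u b v ih₁ ih₂ =>
    simp only [shuffleSum_cons_cons, reverse_cons] at ih₁ ih₂ ⊢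
    rw [ih₁ (fun w => f (w ++ [a])), ih₂ (fun w => f (w ++ [b])), shuffleSum_concat_concat]

theorem shuffleSum_comm (f : List α → M) (u v : List α) :
    shuffleSum f u v = shuffleSum f v u := by
  induction u, v using shuffles.induct generalizing f with
  | case1 v => simp
  | case2 a u => simp
  | case3 a u b v ih₁ ih₂ => rw [shuffleSum_cons_cons, shuffleSum_cons_cons, ih₁, ih₂, add_comm]

theorem shuffleSum_smul {R : Type*} [Semiring R] [Module R M] (c : R) (f : List α → M)
    (u v : List α) : shuffleSum (fun w => c • f w) u v = c • shuffleSum f u v := by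
  simp [shuffleSum, smul_sum, Function.comp_def]

end AddCommMonoid

/-- A function that vanishes on shuffles of nonempty words, read backwards through the letter
`y`. -/
theorem shuffleSum_cons_eq {R : Type*} [CommRing R] {g : List α → R} {r z : List α} {y : α}
    (hg : ∀ u v, u ≠ [] → v ≠ [] → (u ++ v).Perm (r ++ y :: z) → shuffleSum g u v = 0) :
    shuffleSum (fun w => g (y :: w)) r z = (-1) ^ r.length * g (r.reverse ++ y :: z) := by
  induction r generalizing y z with
  | nil => simp
  | cons a r ih =>
    -- A shuffle of `a r` and `y z` starts with `a` or `y`, and the two groups cancel. So `a` moves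
    -- across `y` at the cost of a sign.
    have h := hg (a :: r) (y :: z) (by simp) (by simp) (.refl _)
    rw [shuffleSum_cons_cons] at h
    have h2 := ih (y := a) (z := y :: z) fun u v hu hv hp =>
      hg u v hu hv (hp.trans perm_middle)
    rw [eq_neg_of_add_eq_zero_right h, h2]
    simp [pow_succ]

end List

/-! ### Shuffle-multiplicative series -/

namespace NCSeries

open List

variable {ι K : Type*} [CommRing K]

/-- Cutting a shuffle of `u` and `v` in two amounts to cutting `u` and `v` separately and shuffling
the left pieces and the right pieces: deconcatenation is a morphism for shuffles. -/
theorem shuffleSum_mul (f g : NCSeries ι K) (u v : List ι) :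
    shuffleSum (f * g).coeff u v =
      ∑ i ∈ Finset.range (u.length + 1), ∑ j ∈ Finset.range (v.length + 1),
        shuffleSum f.coeff (u.take i) (v.take j) * shuffleSum g.coeff (u.drop i) (v.drop j) := by
  induction u, v using shuffles.induct generalizing f with
  | case1 v => simp [coeff_mul]
  | case2 a u => simp [coeff_mul]
  | case3 a u b v ih₁ ih₂ =>
    have key (c : ι) (x y : List ι) : shuffleSum (fun w => (f * g).coeff (c :: w)) x y =
        f.coeff [] * shuffleSum (fun w => g.coeff (c :: w)) x y +
          shuffleSum (tail c f * g).coeff x y := by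
      rw [← smul_eq_mul (f.coeff []), ← shuffleSum_smul, ← shuffleSum_add]
      congr 1; funext w
      rw [coeff_mul_cons, smul_eq_mul]
    rw [shuffleSum_cons_cons, key, key, ih₁, ih₂]
    simp only [length_cons, Finset.sum_range_succ' (n := u.length + 1),
      Finset.sum_range_succ' (n := v.length + 1)]
    simp only [take_succ_cons, drop_succ_cons, take_zero, drop_zero, shuffleSum_nil_left,
      shuffleSum_nil_right, shuffleSum_cons_cons, add_mul, Finset.sum_add_distrib, mul_add]
    have e (c : ι) : (tail c f).coeff = fun w => f.coeff (c :: w) := rfl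
    simp only [e]
    ring

/-- Multiplicativity for the shuffle product, on words without repetition. -/
def IsShuffleChar (f : NCSeries ι K) : Prop :=
  ∀ u v : List ι, (u ++ v).Nodup → shuffleSum f.coeff u v = f.coeff u * f.coeff v

theorem isShuffleChar_one : IsShuffleChar (1 : NCSeries ι K) := by
  intro u v _
  rcases u with _ | ⟨a, u⟩
  · simp [coeff_one]
  rw [shuffleSum_congr (g := fun _ => 0), coeff_one (a :: u)]
  · simp [shuffleSum]
  · intro w hw
    have := hw.length_eq
    rw [coeff_one, if_neg (by simp at this; omega)]

theorem IsShuffleChar.mul {f g : NCSeries ι K} (hf : IsShuffleChar f) (hg : IsShuffleChar g) :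
    IsShuffleChar (f * g) := by
  intro u v huv
  rw [shuffleSum_mul, coeff_mul, coeff_mul, Finset.sum_mul_sum]
  refine Finset.sum_congr rfl fun i _ => Finset.sum_congr rfl fun j _ => ?_
  rw [hf _ _ (huv.sublist ((take_sublist _ _).append (take_sublist _ _))),
    hg _ _ (huv.sublist ((drop_sublist _ _).append (drop_sublist _ _)))]
  ring

theorem IsShuffleChar.pow {f : NCSeries ι K} (hf : IsShuffleChar f) (m : ℕ) :
    IsShuffleChar (f ^ m) := by
  induction m with
  | zero => simpa using isShuffleChar_one
  | succ m ih => rw [pow_succ]; exact ih.mul hf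

theorem isShuffleChar_list_prod {l : List (NCSeries ι K)} (h : ∀ f ∈ l, IsShuffleChar f) :
    IsShuffleChar l.prod := by
  induction l with
  | nil => simpa using isShuffleChar_one
  | cons f l ih =>
    rw [prod_cons]
    exact (h f (by simp)).mul (ih fun g hg => h g (by simp [hg]))

end NCSeries

/-! ### The logarithm as linear coefficient of the powers -/

namespace NCSeries

open List Polynomial

section Log

variable {ι K : Type*} [Field K]

/-- The polynomial whose value at `m` is the binomial coefficient `m.choose k`. -/
noncomputable def choosePoly (K : Type*) [Field K] (k : ℕ) : K[X] :=
  C (1 / (k.factorial : K)) * descPochhammer K k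

theorem eval_choosePoly [CharZero K] (k m : ℕ) :
    (choosePoly K k).eval (m : K) = (m.choose k : K) := by
  rw [choosePoly, eval_mul, eval_C, Nat.cast_choose_eq_descPochhammer_div]
  ring

theorem eval_neg_one_descPochhammer (k : ℕ) :
    (descPochhammer K k).eval (-1) = (-1) ^ k * (k.factorial : K) := by
  have h := ascPochhammer_eval_neg_eq_descPochhammer K (-1) k
  rw [neg_neg, ascPochhammer_eval_one] at h
  rw [h, ← mul_assoc, ← mul_pow]
  simp

theorem coeff_one_choosePoly_comp [CharZero K] (c d : ℕ) :
    ((choosePoly K (c + (d + 1))).comp (Polynomial.X + C (c : K))).coeff 1 =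
      (-1) ^ d * ((c.factorial : K) * d.factorial / (c + (d + 1)).factorial) := by
  -- The factors are `(X+c)⋯(X+1)`, `X` and `(X-1)⋯(X-d)`. Removing `X` and evaluating at `0` leaves
  -- `c!` and `(-1)^d d!`.
  have h : (descPochhammer K (c + (d + 1))).comp (Polynomial.X + C (c : K)) =
      Polynomial.X * ((descPochhammer K c).comp (Polynomial.X + C (c : K)) *
        (descPochhammer K d).comp (Polynomial.X - 1)) := by
    rw [← descPochhammer_mul, mul_comp, comp_assoc, descPochhammer_succ_left]
    simp
    ring
  rw [choosePoly, mul_comp, C_comp, h, coeff_C_mul, coeff_X_mul, coeff_zero_eq_eval_zero,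
    eval_mul, eval_comp, eval_comp]
  simp only [eval_add, eval_sub, eval_X, eval_C, eval_one, zero_add, zero_sub]
  rw [eval_neg_one_descPochhammer, descPochhammer_eval_eq_descFactorial, Nat.descFactorial_self]
  ring

theorem coeff_one_choosePoly [CharZero K] (k : ℕ) :
    (choosePoly K (k + 1)).coeff 1 = (-1) ^ k / ((k + 1 : ℕ) : K) := by
  have h := coeff_one_choosePoly_comp (K := K) 0 k
  simp only [Nat.cast_zero, C_0, add_zero, comp_X, zero_add, Nat.factorial_zero, Nat.cast_one,
    one_mul] at h
  rw [h, Nat.factorial_succ]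
  have : (k.factorial : K) ≠ 0 := by exact_mod_cast k.factorial_ne_zero
  have : ((k + 1 : ℕ) : K) ≠ 0 := by exact_mod_cast k.succ_ne_zero
  push_cast at *
  field_simp

/-- The polynomial in `m` that gives the coefficient of a word in the `m`-th power of a series
with constant term `1`. -/
noncomputable def powPoly (g : NCSeries ι K) (w : List ι) : K[X] :=
  ∑ k ∈ Finset.range (w.length + 1), C (((g - 1) ^ k).coeff w) * choosePoly K k

theorem coeff_sum {κ : Type*} (s : Finset κ) (f : κ → NCSeries ι K) (w : List ι) :
    (∑ k ∈ s, f k).coeff w = ∑ k ∈ s, (f k).coeff w := by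
  classical
  induction s using Finset.induction_on with
  | empty => simp
  | insert a s ha ih => rw [Finset.sum_insert ha, Finset.sum_insert ha, coeff_add, ih]

/-- Binomial expansion of `(1 + (g - 1)) ^ m`, truncated because high powers of `g - 1` miss the
word `w`. -/
theorem eval_powPoly [CharZero K] {g : NCSeries ι K} (hg : g.coeff [] = 1) (w : List ι)
    (m : ℕ) : (powPoly g w).eval (m : K) = (g ^ m).coeff w := by
  have h0 : (g - 1).coeff [] = 0 := by simp [hg, coeff_one]
  have hb : g ^ m = ∑ k ∈ Finset.range (m + 1), (m.choose k : K) • (g - 1) ^ k := by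
    conv_lhs => rw [← sub_add_cancel g 1, (Commute.one_right (g - 1)).add_pow]
    refine Finset.sum_congr rfl fun k _ => ?_
    rw [one_pow, mul_one, Nat.cast_smul_eq_nsmul, nsmul_eq_mul, Nat.cast_comm]
  rw [hb, coeff_sum, powPoly, eval_finsetSum]
  simp only [eval_mul, eval_C, eval_choosePoly, coeff_smul]
  -- Both sums are extended to a common range: terms with `k > m` vanish by the binomial, those with
  -- `k > w.length` by the missing constant term.
  rw [Finset.sum_subset (Finset.range_mono (show w.length + 1 ≤ w.length + 1 + m by omega)),
    Finset.sum_subset (Finset.range_mono (show m + 1 ≤ w.length + 1 + m by omega))]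
  · exact Finset.sum_congr rfl fun k _ => mul_comm _ _
  · intro k _ hk
    rw [Finset.mem_range] at hk
    rw [Nat.choose_eq_zero_of_lt (by omega), Nat.cast_zero, zero_mul]
  · intro k _ hk
    rw [Finset.mem_range] at hk
    rw [coeff_pow_eq_zero h0 (by omega), zero_mul]

theorem coeff_zero_powPoly [CharZero K] {g : NCSeries ι K} (hg : g.coeff [] = 1) {w : List ι}
    (hw : w ≠ []) : (powPoly g w).coeff 0 = 0 := by
  have h := eval_powPoly hg w 0
  rw [Nat.cast_zero, ← coeff_zero_eq_eval_zero] at h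
  rw [h, pow_zero, coeff_one, if_neg (by simpa using hw)]

/-- The linear coefficient of `choosePoly K k` is `(-1)^(k-1)/k` for `k ≥ 1`, exactly the weight of
`(g - 1) ^ k` in the logarithm. -/
theorem coeff_one_powPoly [CharZero K] (g : NCSeries ι K) (w : List ι) :
    (powPoly g w).coeff 1 = (log g).coeff w := by
  have h : (log g).coeff w = ∑ k ∈ Finset.Icc 1 w.length,
    (-1 : K) ^ (k - 1) / (k : K) * ((g - 1) ^ k).coeff w := rfl
  rw [h, powPoly, finsetSum_coeff, Finset.sum_range_succ', Finset.range_eq_Ico,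
    Finset.sum_Ico_add' (fun k => (C (((g - 1) ^ k).coeff w) * choosePoly K k).coeff 1),
    zero_add, Finset.Ico_add_one_right_eq_Icc]
  simp only [coeff_C_mul]
  rw [show (choosePoly K 0).coeff 1 = 0 by simp [choosePoly, Polynomial.coeff_one], mul_zero,
    add_zero]
  refine Finset.sum_congr rfl fun k hk => ?_
  obtain ⟨j, rfl⟩ : ∃ j, k = j + 1 := ⟨k - 1, by have := Finset.mem_Icc.1 hk; omega⟩
  rw [coeff_one_choosePoly, Nat.add_sub_cancel, mul_comm]

theorem polynomial_ext_nat [CharZero K] {p q : K[X]}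
    (h : ∀ m : ℕ, p.eval (m : K) = q.eval (m : K)) : p = q := by
  refine eq_of_infinite_eval_eq p q (Set.Infinite.mono ?_
    (Set.infinite_range_of_injective (Nat.cast_injective (R := K))))
  rintro _ ⟨m, rfl⟩
  exact h m

/-- The logarithm of a series that is multiplicative for the shuffle product vanishes on the
shuffles of nonempty words. -/
theorem IsShuffleChar.shuffleSum_log [CharZero K] {g : NCSeries ι K} (hg : g.coeff [] = 1)
    (hc : IsShuffleChar g) {u v : List ι} (hu : u ≠ []) (hv : v ≠ []) (huv : (u ++ v).Nodup) :
    shuffleSum (log g).coeff u v = 0 := by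
  -- Powers of `g` are again multiplicative, so this holds at every natural `m`, hence as
  -- polynomials.
  have h : shuffleSum (powPoly g) u v = powPoly g u * powPoly g v := by
    refine polynomial_ext_nat fun m => ?_
    have := map_shuffleSum (evalRingHom (m : K)).toAddMonoidHom (powPoly g) u v
    simp only [RingHom.toAddMonoidHom_eq_coe, AddMonoidHom.coe_coe, coe_evalRingHom,
      eval_powPoly hg] at this
    rw [this, eval_mul, eval_powPoly hg, eval_powPoly hg]
    exact hc.pow m u v huv
  have h1 := map_shuffleSum (lcoeff K 1).toAddMonoidHom (powPoly g) u v
  simp only [LinearMap.toAddMonoidHom_coe, lcoeff_apply, coeff_one_powPoly] at h1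
  change _ = shuffleSum (log g).coeff u v at h1
  -- A product of two polynomials without constant term has no linear term.
  rw [← h1, h, mul_coeff_one, coeff_zero_powPoly hg hu, coeff_zero_powPoly hg hv]
  ring

end Log

/-! ### Exponentials of variables on words without repetition -/

section Exp

variable {ι K : Type*} [DecidableEq ι]

theorem coeff_X_pow [CommRing K] (i : ι) (k : ℕ) (w : List ι) :
    ((X i : NCSeries ι K) ^ k).coeff w = if w = replicate k i then 1 else 0 := by
  induction k generalizing w with
  | zero => simp [coeff_one]
  | succ k ih =>
    have h0 : (X i : NCSeries ι K).coeff [] = 0 := by simp [X, coeff]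
    rw [pow_succ']
    cases w with
    | nil => rw [coeff_mul_nil, h0, zero_mul, if_neg (by simp [replicate_succ])]
    | cons a w =>
      have ht : tail a (X i : NCSeries ι K) = if a = i then 1 else 0 := by
        ext w
        have h : (tail a (X i : NCSeries ι K)).coeff w = if a :: w = [i] then 1 else 0 := rfl
        rw [h]
        split_ifs <;> simp_all [coeff_one]
      rw [coeff_mul_cons, h0, zero_mul, zero_add, ht]
      split_ifs with h h' h' <;> simp_all [replicate_succ]

variable [Field K]

theorem coeff_exp_X (i : ι) {w : List ι} (hw : w.Nodup) :
    (exp (X i : NCSeries ι K)).coeff w = if w = [] ∨ w = [i] then 1 else 0 := by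
  have h : (exp (X i : NCSeries ι K)).coeff w = ∑ k ∈ Finset.range (w.length + 1),
    1 / (k.factorial : K) * ((X i : NCSeries ι K) ^ k).coeff w := rfl
  rw [h, Finset.sum_eq_single w.length]
  · rw [coeff_X_pow]
    rcases w with _ | ⟨a, _ | ⟨b, w⟩⟩
    · simp
    · simp
    · rw [if_neg, if_neg (by simp), mul_zero]
      intro hr
      simp only [length_cons, replicate_succ, cons.injEq] at hr
      simp [hr.1, hr.2.1] at hw
  · intro k _ hk
    rw [coeff_X_pow, if_neg, mul_zero]
    rintro rfl
    simp at hk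
  · simp

/-- For nonempty `u`, `v` both sides vanish: shuffles have length at least two, and `u`, `v` cannot
both be the letter `i`. -/
theorem isShuffleChar_exp_X (i : ι) : IsShuffleChar (exp (X i : NCSeries ι K)) := by
  intro u v huv
  have h0 : (exp (X i : NCSeries ι K)).coeff [] = 1 := by
    rw [coeff_exp_X i nodup_nil, if_pos (.inl rfl)]
  rcases u with _ | ⟨a, u⟩
  · simp [h0]
  rcases v with _ | ⟨b, v⟩
  · simp [h0]
  rw [shuffleSum_congr (g := fun _ => 0), coeff_exp_X i huv.of_append_left,
    coeff_exp_X i huv.of_append_right]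
  · have : ¬(a :: u = [i] ∧ b :: v = [i]) := by
      rintro ⟨h₁, h₂⟩
      simp [h₁, h₂] at huv
    simp only [reduceCtorEq, false_or]
    split_ifs <;> simp_all [shuffleSum]
  · intro w hw
    rw [coeff_exp_X i (hw.nodup_iff.2 huv), if_neg]
    have := hw.length_eq
    rintro (rfl | rfl) <;> simp at this

/-- Each factor contributes its letter at most once, so a word arises exactly when it follows the
order of `l`, and then in one way. -/
theorem coeff_prod_exp_X {l w : List ι} (hl : l.Nodup) (hw : w.Nodup) :
    (l.map fun i => exp (X i : NCSeries ι K)).prod.coeff w =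
      if w.Sublist l then 1 else 0 := by
  induction l generalizing w with
  | nil => simp [coeff_one]
  | cons i l ih =>
    have hl' := nodup_cons.1 hl
    have h0 : (exp (X i : NCSeries ι K)).coeff [] = 1 := by
      rw [coeff_exp_X i nodup_nil, if_pos (.inl rfl)]
    rw [map_cons, prod_cons]
    cases w with
    | nil => rw [coeff_mul_nil, h0, ih hl'.2 nodup_nil]; simp
    | cons a w =>
      have hw' := nodup_cons.1 hw
      rw [coeff_mul_cons, h0, one_mul, ih hl'.2 hw, coeff_mul, Finset.sum_eq_single 0]
      · rw [take_zero, drop_zero, coeff_tail, coeff_exp_X i (nodup_singleton a), ih hl'.2 hw'.2]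
        simp only [cons_sublist_cons']
        by_cases h : a = i
        · subst h
          have : ¬(a :: w).Sublist l := fun h => hl'.1 (h.subset mem_cons_self)
          simp [this]
        · simp [h]
      · intro j hj hj0
        have hn : w.take j ≠ [] := by
          rw [Finset.mem_range] at hj
          intro h
          have := congrArg List.length h
          rw [length_take, length_nil] at this
          omega
        rw [coeff_tail, coeff_exp_X i (hw.sublist ((take_sublist j w).cons_cons a)), if_neg,
          zero_mul]
        simp [hn]
      · simp

end Exp

end NCSeries

/-! ### Descents of words -/

namespace List

variable {α : Type*} [LinearOrder α]

/-- The number of descents of a word. -/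
def descentCount : List α → ℕ
  | [] => 0
  | [_] => 0
  | a :: b :: w => descentCount (b :: w) + if b < a then 1 else 0

theorem descentCount_cons_le (a : α) (w : List α) : descentCount (a :: w) ≤ w.length := by
  induction w generalizing a with
  | nil => simp [descentCount]
  | cons b w ih =>
    have := ih b
    rw [descentCount, length_cons]
    split_ifs <;> omega

theorem descentCount_concat {w : List α} {y : α} (h : ∀ x ∈ w, x < y) :
    descentCount (w ++ [y]) = descentCount w := by
  induction w with
  | nil => simp [descentCount]
  | cons a w ih =>
    have ih := ih fun x hx => h x (mem_cons_of_mem _ hx)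
    cases w with
    | nil => simpa [descentCount] using (h a (by simp)).le
    | cons b w =>
      simp only [cons_append, descentCount] at ih ⊢
      rw [ih]

theorem descentCount_map {β : Type*} [LinearOrder β] {f : α → β} (hf : StrictMono f)
    (w : List α) : descentCount (w.map f) = descentCount w := by
  induction w with
  | nil => rfl
  | cons a w ih =>
    cases w with
    | nil => rfl
    | cons b w =>
      simp only [map_cons, descentCount] at ih ⊢
      rw [ih]
      simp [hf.lt_iff_lt]

theorem descentCount_ofFn {n : ℕ} (f : Fin n → α) :
    descentCount (List.ofFn f) =
      (Finset.univ.filter fun i : Fin n => ∃ h : i.val + 1 < n, f i > f ⟨i.val + 1, h⟩).card := by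
  induction n with
  | zero => simp [descentCount]
  | succ n ih =>
    have ih := ih fun i => f i.succ
    rw [Finset.card_filter] at ih ⊢
    rw [ofFn_succ, Fin.sum_univ_succ]
    cases n with
    | zero =>
      rw [if_neg (fun ⟨h, _⟩ => lt_irrefl _ h), ofFn_zero, Fin.sum_univ_zero]
      rfl
    | succ n =>
      rw [ofFn_succ] at ih ⊢
      rw [descentCount, ih, add_comm]
      congr 1
      · simp [Fin.succ]
      · exact Finset.sum_congr rfl fun i _ => by simp [Fin.succ]

end List

/-! ### Descents and the coefficients of powers and logarithm -/

namespace NCSeries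

open List

variable {ι K : Type*} [LinearOrder ι]

/-- Either the increasing prefix taken by `g` is empty, or it contains `a`. In the latter case it
stops there if `b < a`; otherwise deleting `a` leaves an arbitrary increasing prefix of `b :: w`. -/
theorem coeff_mul_cons_cons [CommRing K] {g : NCSeries ι K}
    (hg : ∀ w : List ι, w.Nodup → g.coeff w = if w.Pairwise (· < ·) then 1 else 0)
    (f : NCSeries ι K) {a b : ι} {w : List ι} (hw : (a :: b :: w).Nodup) :
    (g * f).coeff (a :: b :: w) =
      f.coeff (a :: b :: w) + if b < a then f.coeff (b :: w) else (g * f).coeff (b :: w) := by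
  have hab : a ≠ b := by rintro rfl; simp at hw
  rw [coeff_mul_cons, hg [] nodup_nil, if_pos Pairwise.nil, one_mul]
  congr 1
  split_ifs with h
  · rw [coeff_mul, Finset.sum_eq_single 0]
    · rw [take_zero, coeff_tail, hg [a] (nodup_singleton a), if_pos (pairwise_singleton _ _),
        drop_zero, one_mul]
    · intro i _ hi
      obtain ⟨i, rfl⟩ := Nat.exists_eq_succ_of_ne_zero hi
      rw [coeff_tail, hg _ (hw.sublist ((take_sublist _ _).cons_cons a)), if_neg, zero_mul]
      rw [take_succ_cons]
      intro hp
      exact lt_asymm h ((pairwise_cons.1 hp).1 b mem_cons_self)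
    · simp
  · have h := lt_of_le_of_ne (not_lt.1 h) hab
    rw [coeff_mul, coeff_mul]
    refine Finset.sum_congr rfl fun i _ => ?_
    congr 1
    rw [coeff_tail, hg _ (hw.sublist ((take_sublist _ _).cons_cons a)),
      hg _ ((nodup_cons.1 hw).2.sublist (take_sublist _ _))]
    refine if_congr ?_ rfl rfl
    rcases i with _ | i
    · simp
    · rw [take_succ_cons, pairwise_cons, and_iff_right_iff_imp]
      intro hp x hx
      rcases mem_cons.1 hx with rfl | hx
      · exact h
      · exact h.trans ((pairwise_cons.1 hp).1 x hx)

/-- Counts cuttings into `m` increasing factors: every descent forces a cut, the other cuts are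
free. The induction turns the recursion of `coeff_mul_cons_cons` into Pascal's rule. -/
theorem coeff_pow_eq_choose [CommRing K] {g : NCSeries ι K}
    (hg : ∀ w : List ι, w.Nodup → g.coeff w = if w.Pairwise (· < ·) then 1 else 0)
    (m : ℕ) {a : ι} {w : List ι} (hw : (a :: w).Nodup) :
    (g ^ m).coeff (a :: w) =
      ((m + (w.length - descentCount (a :: w))).choose (w.length + 1) : ℕ) := by
  induction w generalizing a m with
  | nil =>
    induction m with
    | zero => simp [coeff_one]
    | succ m ih =>
      rw [pow_succ', coeff_mul_cons, ih, coeff_mul_nil, coeff_tail, hg _ nodup_nil,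
        hg _ (nodup_singleton a)]
      have : (g ^ m).coeff [] = 1 := by
        clear ih
        induction m with
        | zero => simp [coeff_one]
        | succ m ih => rw [pow_succ', coeff_mul_nil, ih, hg _ nodup_nil]; simp
      simp [this]
  | cons b w ih =>
    induction m with
    | zero =>
      rw [pow_zero, coeff_one, if_neg (by simp), Nat.choose_eq_zero_of_lt, Nat.cast_zero]
      simp only [length_cons]; omega
    | succ m ihm =>
      have hw' := (nodup_cons.1 hw).2
      have hd := descentCount_cons_le b w
      rw [pow_succ', coeff_mul_cons_cons hg _ hw, ihm, ← pow_succ', ih _ hw', ih _ hw',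
        descentCount, length_cons]
      generalize descentCount (b :: w) = d at *
      split_ifs with h
      · rw [show m + 1 + (w.length + 1 - (d + 1)) = m + (w.length - d) + 1 by omega,
          Nat.choose_succ_succ, show w.length + 1 - (d + 1) = w.length - d by omega]
        push_cast; ring
      · rw [show m + 1 + (w.length + 1 - (d + 0)) = m + (w.length + 1 - (d + 0)) + 1 by omega,
          Nat.choose_succ_succ,
          show m + 1 + (w.length - d) = m + (w.length + 1 - (d + 0)) by omega]
        push_cast; ring

theorem coeff_log_eq [Field K] [CharZero K] {g : NCSeries ι K}
    (hg : ∀ w : List ι, w.Nodup → g.coeff w = if w.Pairwise (· < ·) then 1 else 0)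
    {a : ι} {w : List ι} (hw : (a :: w).Nodup) :
    (log g).coeff (a :: w) = 1 / ((w.length + 1 : ℕ) : K) *
      ((-1) ^ descentCount (a :: w) *
        (1 / (w.length.choose (descentCount (a :: w)) : ℕ))) := by
  have h0 : g.coeff [] = 1 := by simp [hg]
  have hd := descentCount_cons_le a w
  -- `c` is the number of ascents.
  obtain ⟨c, hc⟩ := Nat.exists_eq_add_of_le hd
  have hp := coeff_pow_eq_choose hg (hw := hw)
  generalize descentCount (a :: w) = d at *
  have h : powPoly g (a :: w) =
      (choosePoly K (c + (d + 1))).comp (Polynomial.X + Polynomial.C (c : K)) := by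
    refine polynomial_ext_nat fun m => ?_
    rw [eval_powPoly h0, hp, Polynomial.eval_comp, Polynomial.eval_add, Polynomial.eval_X,
      Polynomial.eval_C, ← Nat.cast_add, eval_choosePoly, hc]
    congr 2 <;> omega
  have h1 : (c.factorial : K) ≠ 0 := by exact_mod_cast c.factorial_ne_zero
  have h2 : (d.factorial : K) ≠ 0 := by exact_mod_cast d.factorial_ne_zero
  have h3 : ((d + c).factorial : K) ≠ 0 := by exact_mod_cast (d + c).factorial_ne_zero
  have h4 : ((d + c + 1 : ℕ) : K) ≠ 0 := by exact_mod_cast (d + c).succ_ne_zero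
  rw [← coeff_one_powPoly, h, coeff_one_choosePoly_comp, hc,
    Nat.cast_choose K (Nat.le_add_right d c), Nat.add_sub_cancel_left,
    show c + (d + 1) = d + c + 1 by ring, Nat.factorial_succ]
  push_cast at *
  field_simp

end NCSeries

/-! ### Expansion of nested commutators -/

namespace BCH

open NCSeries List

section Commutators

variable {ι K : Type*} [DecidableEq ι] [CommRing K]

theorem coeff_X_mul_cons (a b : ι) (g : NCSeries ι K) (w : List ι) :
    (X a * g).coeff (b :: w) = if a = b then g.coeff w else 0 := by
  have ht : tail b (X a : NCSeries ι K) = if a = b then 1 else 0 := by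
    ext w
    have h : (tail b (X a : NCSeries ι K)).coeff w = if b :: w = [a] then 1 else 0 := rfl
    rw [h]
    split_ifs <;> simp_all [coeff_one]
  have h0 : (X a : NCSeries ι K).coeff [] = 0 := by simp [X, coeff]
  rw [coeff_mul_cons, h0, zero_mul, zero_add, ht]
  split_ifs <;> simp

theorem coeff_mul_X_concat (a b : ι) (g : NCSeries ι K) (w : List ι) :
    (g * X a).coeff (w ++ [b]) = if a = b then g.coeff w else 0 := by
  induction w generalizing g with
  | nil =>
    rw [nil_append, coeff_mul_cons, coeff_mul_nil]
    by_cases h : a = b <;> simp [X, coeff, h, eq_comm]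
  | cons c w ih =>
    rw [cons_append, coeff_mul_cons, ih, coeff_tail]
    simp [X, coeff]

theorem coeff_mul_X_nil (a : ι) (g : NCSeries ι K) : (g * X a).coeff [] = 0 := by
  rw [coeff_mul_nil]; simp [X, coeff]

theorem coeff_X_mul_nil (a : ι) (g : NCSeries ι K) : (X a * g).coeff [] = 0 := by
  rw [coeff_mul_nil]; simp [X, coeff]

/-- A right-nested commutator of letters involves only the arrangements of these letters. -/
theorem perm_of_coeff_rightNested_ne_zero {l w : List ι} {y : ι}
    (h : (rightNested (l.map (X : ι → NCSeries ι K)) (X y)).coeff w ≠ 0) :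
    w.Perm (l ++ [y]) := by
  induction l generalizing w with
  | nil =>
    by_contra hw
    refine h ?_
    have : w ≠ [y] := fun e => hw (e ▸ .refl _)
    simp [rightNested, X, coeff, this]
  | cons a l ih =>
    change (⁅X a, rightNested (l.map (X : ι → NCSeries ι K)) (X y)⁆).coeff w ≠ 0 at h
    rw [Ring.lie_def, coeff_sub] at h
    rcases ne_or_eq ((X a * rightNested (l.map (X : ι → NCSeries ι K)) (X y)).coeff w) 0
      with h1 | h1
    · cases w with
      | nil => exact absurd (coeff_X_mul_nil _ _) h1
      | cons b w =>
        rw [coeff_X_mul_cons] at h1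
        obtain ⟨rfl, h2⟩ := ite_ne_right_iff.1 h1
        exact (ih h2).cons a
    · rw [h1, zero_sub, neg_ne_zero] at h
      rcases eq_nil_or_concat' w with rfl | ⟨w, b, rfl⟩
      · exact absurd (coeff_mul_X_nil _ _) h
      · rw [coeff_mul_X_concat] at h
        obtain ⟨rfl, h2⟩ := ite_ne_right_iff.1 h
        exact (perm_append_singleton a w).trans ((ih h2).cons a)

/-- Each bracket puts its letter at the left end, or at the right end with a sign. Read from the
outside in, `l` is thus dealt out to `u` and `v` in order, that is, `l` is a shuffle of `u` and `v`.
-/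
theorem coeff_rightNested {l : List ι} {y : ι} (hy : y ∉ l) (u v : List ι) :
    (rightNested (l.map (X : ι → NCSeries ι K)) (X y)).coeff (u ++ y :: v.reverse) =
      (-1) ^ v.length * ((shuffles u v).count l : K) := by
  induction l generalizing u v with
  | nil =>
    have h : (rightNested ([].map (X : ι → NCSeries ι K)) (X y)).coeff (u ++ y :: v.reverse) =
      if u ++ y :: v.reverse = [y] then 1 else 0 := rfl
    rw [h]
    rcases u with _ | ⟨b, u⟩ <;> rcases v with _ | ⟨c, v⟩ <;>
      simp [shuffles_cons_cons, count_eq_zero_of_not_mem]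
  | cons a l ih =>
    simp only [mem_cons, not_or] at hy
    have ih := ih hy.2
    change (⁅X a, rightNested (l.map (X : ι → NCSeries ι K)) (X y)⁆).coeff _ = _
    rw [Ring.lie_def, coeff_sub]
    have hinj (b : ι) : Function.Injective (b :: · : List ι → List ι) := cons_injective
    have hc (b : ι) (L : List (List ι)) :
        (L.map (b :: ·)).count (a :: l) = if a = b then L.count l else 0 := by
      split_ifs with h
      · subst h; exact count_map_of_injective _ _ (hinj a) _
      · rw [count_eq_zero, mem_map]
        rintro ⟨x, _, hx⟩
        exact h (cons.inj hx).1.symm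
    have hL : (X a * rightNested (l.map (X : ι → NCSeries ι K)) (X y)).coeff
        (u ++ y :: v.reverse) = (-1) ^ v.length * (match u with
          | [] => 0
          | b :: u => if a = b then ((shuffles u v).count l : K) else 0) := by
      cases u with
      | nil => rw [nil_append, coeff_X_mul_cons, if_neg (Ne.symm hy.1), mul_zero]
      | cons b u =>
        rw [cons_append, coeff_X_mul_cons, ih]
        simp
    have hR : (rightNested (l.map (X : ι → NCSeries ι K)) (X y) * X a).coeff
        (u ++ y :: v.reverse) = - ((-1) ^ v.length * (match v with
          | [] => 0
          | b :: v => if a = b then ((shuffles u v).count l : K) else 0)) := by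
      cases v with
      | nil => rw [reverse_nil, coeff_mul_X_concat, if_neg (Ne.symm hy.1)]; simp
      | cons b v =>
        rw [reverse_cons, ← cons_append, ← append_assoc, coeff_mul_X_concat, ih]
        simp only [length_cons, pow_succ]
        split_ifs <;> ring
    rw [hL, hR, sub_neg_eq_add, ← mul_add]
    congr 1
    rcases u with _ | ⟨b, u⟩ <;> rcases v with _ | ⟨c, v⟩
    · simp
    · simp only [shuffles_nil_left, zero_add]
      rw [show [c :: v] = [v].map (c :: ·) from rfl, hc]; split_ifs <;> simp
    · simp only [shuffles_nil_right, add_zero]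
      rw [show [b :: u] = [u].map (b :: ·) from rfl, hc]; split_ifs <;> simp
    · simp only [shuffles_cons_cons, count_append, hc]
      push_cast; rfl

end Commutators

/-! ### Permutations as words -/

/-- The word `σ(1) … σ(n)`. -/
def permWord {n : ℕ} (σ : Equiv.Perm (Fin n)) : List (Fin (n + 1)) :=
  List.ofFn fun i : Fin n => (σ i).castSucc

theorem permWord_injective {n : ℕ} : Function.Injective (permWord (n := n)) := by
  intro σ τ h
  ext i
  have := congrFun (List.ofFn_injective h) i
  simpa using congrArg Fin.val this

theorem last_notMem_permWord {n : ℕ} (σ : Equiv.Perm (Fin n)) : Fin.last n ∉ permWord σ := by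
  simp [permWord, List.mem_ofFn, Fin.castSucc_ne_last]

theorem nodup_permWord {n : ℕ} (σ : Equiv.Perm (Fin n)) : (permWord σ).Nodup :=
  List.nodup_ofFn.2 ((Fin.castSucc_injective n).comp σ.injective)

theorem nodup_permWord_concat {n : ℕ} (σ : Equiv.Perm (Fin n)) :
    (permWord σ ++ [Fin.last n]).Nodup := by
  simp [List.nodup_append, nodup_permWord]
  rintro a h rfl
  exact last_notMem_permWord σ h

theorem exists_permWord_eq {n : ℕ} {w : List (Fin (n + 1))} (hw : w.Nodup)
    (hl : w.length = n) (hy : Fin.last n ∉ w) : ∃ σ, permWord σ = w := by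
  have hne (i : Fin n) : w.get (i.cast hl.symm) ≠ Fin.last n := fun h =>
    hy (h ▸ List.get_mem _ _)
  let f : Fin n → Fin n := fun i => (w.get (i.cast hl.symm)).castPred (hne i)
  have hf : Function.Injective f := by
    intro i j h
    have := hw.injective_get (Fin.castPred_inj.1 h)
    simpa using this
  refine ⟨Equiv.ofBijective f (Finite.injective_iff_bijective.1 hf), ?_⟩
  refine List.ext_get (by simp [permWord, hl]) fun i h₁ h₂ => ?_
  simp [permWord, f]

theorem descentCount_permWord_concat {n : ℕ} (σ : Equiv.Perm (Fin n)) :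
    (permWord σ ++ [Fin.last n]).descentCount = descents σ := by
  rw [descentCount_concat]
  · have : permWord σ = (List.ofFn σ).map Fin.castSucc := by
      simp [permWord, List.map_ofFn, Function.comp_def]
    rw [this, descentCount_map (Fin.strictMono_castSucc), descentCount_ofFn]
    rfl
  · intro x hx
    exact Fin.lt_last_iff_ne_last.2 fun h => last_notMem_permWord σ (h ▸ hx)

/-! ### Comparison of coefficients -/

section

variable (K : Type*) [Field K]

theorem dragtForest_eq {n : ℕ} (σ : Equiv.Perm (Fin n)) :
    dragtForest K n σ =
      rightNested ((permWord σ).map (X : _ → NCSeries (Fin (n + 1)) K)) (X (Fin.last n)) := by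
  simp [dragtForest, permWord, List.map_ofFn, Function.comp_def]

theorem coeff_dragtForest {n : ℕ} (σ : Equiv.Perm (Fin n)) (u v : List (Fin (n + 1))) :
    (dragtForest K n σ).coeff (u ++ Fin.last n :: v) =
      (-1) ^ v.length * ((shuffles u v.reverse).count (permWord σ) : K) := by
  have := coeff_rightNested (K := K) (last_notMem_permWord σ) u v.reverse
  rw [reverse_reverse, length_reverse] at this
  rw [dragtForest_eq, this]

/-- With nothing to the right of the last variable, the only shuffle is the word itself; so these
words are dual to the commutators. -/
theorem coeff_dragtForest_permWord {n : ℕ} (σ τ : Equiv.Perm (Fin n)) :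
    (dragtForest K n σ).coeff (permWord τ ++ [Fin.last n]) = if τ = σ then 1 else 0 := by
  rw [coeff_dragtForest]
  simp [count_singleton, permWord_injective.eq_iff]

theorem linearIndependent_dragtForest (n : ℕ) :
    LinearIndependent K (fun σ : Equiv.Perm (Fin n) => dragtForest K n σ) := by
  rw [Fintype.linearIndependent_iff]
  intro c hc τ
  have h := congrArg (fun f => coeff f (permWord τ ++ [Fin.last n])) hc
  simpa [coeff_sum, coeff_dragtForest_permWord] using h

/-- The product `exp X_1 * ⋯ * exp X_n`. -/
noncomputable def expProd (n : ℕ) : NCSeries (Fin n) K :=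
  (List.ofFn fun i : Fin n => NCSeries.exp (X i : NCSeries (Fin n) K)).prod

theorem expProd_eq (n : ℕ) : expProd K n =
    ((List.finRange n).map fun i => NCSeries.exp (X i : NCSeries (Fin n) K)).prod := by
  rw [expProd, List.ofFn_eq_map]

theorem coeff_expProd {n : ℕ} {w : List (Fin n)} (hw : w.Nodup) :
    (expProd K n).coeff w = if w.Pairwise (· < ·) then 1 else 0 := by
  rw [expProd_eq, coeff_prod_exp_X (nodup_finRange n) hw]
  refine if_congr ⟨fun h => (pairwise_lt_finRange n).sublist h, fun h => ?_⟩ rfl rfl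
  exact sublist_of_subperm_of_pairwise (subperm_of_subset hw fun x _ => mem_finRange x) h
    (pairwise_lt_finRange n)

theorem isShuffleChar_expProd (n : ℕ) : IsShuffleChar (expProd K n) := by
  refine isShuffleChar_list_prod fun f hf => ?_
  obtain ⟨i, rfl⟩ := List.mem_ofFn.1 hf
  exact isShuffleChar_exp_X i

variable [CharZero K]

theorem coeff_bchSeries_permWord {n : ℕ} (σ : Equiv.Perm (Fin n)) :
    (bchSeries K (n + 1)).coeff (permWord σ ++ [Fin.last n]) = 1 / ((n + 1 : ℕ) : K) *
      ((-1) ^ descents σ * (1 / (n.choose (descents σ) : ℕ))) := by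
  have hl : (permWord σ ++ [Fin.last n]).length = n + 1 := by simp [permWord]
  have hd := descentCount_permWord_concat σ
  have hn := nodup_permWord_concat σ
  obtain ⟨a, w, hw⟩ := List.exists_cons_of_length_eq_add_one hl
  rw [hw] at hl hd hn ⊢
  have h := coeff_log_eq (K := K) (fun w hw => coeff_expProd K hw) hn
  rw [hd, show w.length = n by simpa using hl] at h
  exact h

/-- The coefficients of the series at the words ending in `y` determine its coefficients at
all words of degree one in `y`. -/
theorem coeff_bchSeries_append_cons {n : ℕ} {u v : List (Fin n)} {y : Fin n}
    (h : (u ++ y :: v).Nodup) :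
    (bchSeries K n).coeff (u ++ y :: v) =
      (-1) ^ v.length *
        shuffleSum (fun w => (bchSeries K n).coeff (w ++ [y])) u v.reverse := by
  set f := bchSeries K n
  have h0 : (expProd K n).coeff [] = 1 := by simp [coeff_expProd]
  -- `shuffleSum_cons_eq` moves letters from the left of `y` to its right; here `v` must move left,
  -- so everything is read backwards.
  have key := shuffleSum_cons_eq (g := fun w => f.coeff w.reverse) (r := v) (z := u.reverse)
    (y := y) (fun a b ha hb hab => by
      rw [shuffleSum_reverse]
      refine (isShuffleChar_expProd K n).shuffleSum_log h0 (by simpa) (by simpa) ?_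
      have e : (a.reverse ++ b.reverse).Perm (u ++ y :: v) := by
        refine ((reverse_perm a).append (reverse_perm b)).trans (hab.trans ?_)
        refine perm_append_comm.trans ?_
        exact ((reverse_perm u).cons y |>.append_right v).trans perm_middle.symm
      exact e.nodup_iff.2 h)
  simp only [reverse_cons, reverse_append, reverse_reverse] at key
  rw [append_assoc, singleton_append] at key
  have hcomm : shuffleSum (fun w => f.coeff (w.reverse ++ [y])) v u.reverse =
      shuffleSum (fun w => f.coeff (w ++ [y])) u v.reverse := by
    have := shuffleSum_reverse (fun w => f.coeff (w ++ [y])) v u.reverse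
    rw [this, reverse_reverse]
    exact shuffleSum_comm _ _ _
  rw [← hcomm, key, ← mul_assoc, ← mul_pow]
  simp

/-- At `u X_{n+1} v` both sides are `(-1)^|v|` times a sum over shuffles of `u` and reversed `v`.
The multiplicity of `σ` among these shuffles is, up to this sign, the coefficient of its commutator.
-/
theorem bchMultilinear_eq (n : ℕ) :
    bchMultilinear K (n + 1) = ∑ σ : Equiv.Perm (Fin n),
      (bchSeries K (n + 1)).coeff (permWord σ ++ [Fin.last n]) • dragtForest K n σ := by
  ext w
  have hw : (bchMultilinear K (n + 1)).coeff w = if w.Nodup then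
    (if w.length = n + 1 then (bchSeries K (n + 1)).coeff w else 0) else 0 := rfl
  rw [hw, coeff_sum]
  by_cases h : w.Nodup ∧ w.length = n + 1
  · rw [if_pos h.1, if_pos h.2]
    have hmem : Fin.last n ∈ w := by
      have := (List.subperm_of_subset h.1 fun x _ => mem_finRange x).perm_of_length_le
        (by simp [h.2])
      exact this.mem_iff.2 (mem_finRange _)
    obtain ⟨u, v, rfl⟩ := append_of_mem hmem
    rw [coeff_bchSeries_append_cons K h.1]
    simp only [coeff_smul, coeff_dragtForest]
    rw [shuffleSum, Finset.sum_list_map_count, Finset.mul_sum]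
    have hnd := List.nodup_middle.1 h.1
    -- Every shuffle that occurs arranges the first `n` variables, so the sum can run over
    -- permutations.
    have hsub : (shuffles u v.reverse).toFinset ⊆ Finset.univ.image (permWord (n := n)) := by
      intro x hx
      have hp := (perm_append_of_mem_shuffles (List.mem_toFinset.1 hx)).trans
        ((Perm.refl u).append (reverse_perm v))
      obtain ⟨σ, hσ⟩ := exists_permWord_eq (hp.nodup_iff.2 (nodup_cons.1 hnd).2)
        (by have := h.2; have := hp.length_eq; simp at *; omega)
        (fun hx => (nodup_cons.1 hnd).1 (hp.mem_iff.1 hx))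
      exact Finset.mem_image.2 ⟨σ, Finset.mem_univ _, hσ⟩
    rw [Finset.sum_subset hsub, Finset.sum_image permWord_injective.injOn]
    · refine Finset.sum_congr rfl fun σ _ => ?_
      rw [nsmul_eq_mul, mul_comm (Nat.cast _), mul_left_comm]
      congr!
    · intro x _ hx
      refine mul_eq_zero_of_right _ (smul_eq_zero_of_left ?_ _)
      convert count_eq_zero_of_not_mem fun h => hx (List.mem_toFinset.2 h)
  · rw [← ite_and, if_neg h, eq_comm]
    refine Finset.sum_eq_zero fun σ _ => ?_
    rw [coeff_smul]
    by_contra hne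
    -- Commutators contain only arrangements of all the variables, so the right side also vanishes
    -- at the remaining words.
    have hp := perm_of_coeff_rightNested_ne_zero (dragtForest_eq K σ ▸ right_ne_zero_of_mul hne)
    exact h ⟨hp.nodup_iff.2 (nodup_permWord_concat σ), by simp [hp.length_eq, permWord]⟩

end

end BCH

/-- The number of variables is `n + 1`, with `n : ℕ` arbitrary. -/
theorem mainTheorem1 (K : Type*) [Field K] [CharZero K] (n : ℕ) :
    BCH.bchMultilinear K (n + 1) =
        (1 / ((n + 1 : ℕ) : K)) •
          ∑ σ : Equiv.Perm (Fin n),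
            ((-1 : K) ^ BCH.descents σ * (1 / ((n.choose (BCH.descents σ) : ℕ) : K))) •
              BCH.dragtForest K n σ ∧
      LinearIndependent K (fun σ : Equiv.Perm (Fin n) => BCH.dragtForest K n σ) := by
  refine ⟨?_, BCH.linearIndependent_dragtForest K n⟩
  rw [BCH.bchMultilinear_eq, Finset.smul_sum]
  refine Finset.sum_congr rfl fun σ _ => ?_
  rw [BCH.coeff_bchSeries_permWord, smul_smul]
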